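/- For $k\in\mathbb N$ let $V^{k/2}$ denote the spin-$k/2$ representation of $\mathrm{SU}(2)$, of dimension $k+1$ (the $k$-th symmetric power of $\mathbb C^2$). For $n\in\mathbb N$ and $x\in\frac12\mathbb Z$ let ${\rm RW}_n(x)$ be the number of $2n$-step walks on $\frac12\mathbb Z$ with steps $\pm\frac12$ that start at $0$ and end at $x$, and let ${\rm RWM}_n(x)$ be the number of those of them that obey a mirror at $0$, i.e. for which every step made from $0$ is $+\frac12$. (These are the "numbers of returns to $x$" after $2n$ iterations, without and with mirror.) Then: 1. The tensor product $(V^{1/2})^{\otimes 2n}$, with the diagonal action of $\mathrm{SU}(2)$, is isomorphic to $\bigoplus_{k\ge 0}(V^{k/2})^{\oplus m_k}$ if and only if $m_k={\rm RWM}_n(k/2)$ for every $k\in\mathbb N$. In particular the multiplicity of spin $j\in\mathbb N$ is $d^{(n)}_j={\rm RWM}_n(j)$. 2. For all $n,k\in\mathbb N$, ${\rm RWM}_n(k/2)={\rm RW}_n(k/2)-{\rm RW}_n(k/2+1)$. For all $n,j\in\mathbb N$, ${\rm RW}_n(j)=\binom{2n}{n+j}$, so that $d^{(n)}_j=\binom{2n}{n+j}-\binom{2n}{n+j+1}$.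 3. The dimension $N=N(n)$ of the space of $\mathrm{SU}(2)$-invariant vectors of $(V^{1/2})^{\otimes 2n}$ (the intertwiner space) is $N=d^{(n)}_0=\frac1{n+1}\binom{2n}{n}$, the $n$-th Catalan number. 4. As $n\to\infty$, $\ln N=2n\ln 2-\frac32\ln n-\frac12\ln\pi+o(1)$. -/

import Mathlib

open Filter Topology

noncomputable section

/-! ### Random walks of step `1/2` on the half-integer line -/

/-- The position, after `k` iterations, of the walk which starts at the origin and whose `i`-th
step is `+1/2` if `ε i = 1` and `-1/2` if `ε i = -1`. -/
def walkPos {N : ℕ} (ε : Fin N → ℤˣ) (k : ℕ) : ℚ :=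
  ∑ i : Fin N with i.val < k, ((ε i : ℤ) : ℚ) / 2

/-- The walk obeys the mirror at the origin: whenever it stands at `0`, the next step can only be
the step `+1/2` (everywhere else both steps are allowed). -/
def ObeysMirror {N : ℕ} (ε : Fin N → ℤˣ) : Prop :=
  ∀ k : Fin N, walkPos ε k.val = 0 → ε k = 1

/-- The number of returns to the spot `x` after `N` iterations of the standard random walk
of step `1/2` starting at the origin. -/
def walkReturns (N : ℕ) (x : ℚ) : ℕ :=
  Nat.card {ε : Fin N → ℤˣ // walkPos ε N = x}

/-- The number of returns to the spot `x` after `N` iterations of the random walk of step `1/2`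
with a mirror at `0`, starting at the origin. -/
def mirrorWalkReturns (N : ℕ) (x : ℚ) : ℕ :=
  Nat.card {ε : Fin N → ℤˣ // ObeysMirror ε ∧ walkPos ε N = x}

/-! ### Representations of `SU(2)` -/

/-- The group `SU(2)`. -/
abbrev SU2 : Type := Matrix.specialUnitaryGroup (Fin 2) ℂ

/-- The linear substitution `x_i ↦ ∑ j, g j i • x_j` on polynomials in two variables. On linear
forms it is the action of the matrix `g` on `ℂ²` with standard basis `x_0, x_1`. -/
def linSubst (g : Matrix (Fin 2) (Fin 2) ℂ) :
    MvPolynomial (Fin 2) ℂ →ₐ[ℂ] MvPolynomial (Fin 2) ℂ :=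
  MvPolynomial.aeval fun i => ∑ j, MvPolynomial.C (g j i) * MvPolynomial.X j

theorem linSubst_one : linSubst 1 = AlgHom.id ℂ _ := by
  ext i : 1
  simp [linSubst, Matrix.one_apply]

theorem linSubst_mul (g h : Matrix (Fin 2) (Fin 2) ℂ) :
    linSubst (g * h) = (linSubst g).comp (linSubst h) := by
  ext i : 1
  simp [linSubst, Matrix.mul_apply, Fin.sum_univ_two]
  ring

theorem linSubst_mem (g : Matrix (Fin 2) (Fin 2) ℂ) (k : ℕ) {p : MvPolynomial (Fin 2) ℂ}
    (hp : p ∈ MvPolynomial.homogeneousSubmodule (Fin 2) ℂ k) :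
    linSubst g p ∈ MvPolynomial.homogeneousSubmodule (Fin 2) ℂ k := by
  have := MvPolynomial.IsHomogeneous.aeval (n := 1) hp
    (fun i => ∑ j, MvPolynomial.C (g j i) * MvPolynomial.X j)
    (fun i => MvPolynomial.IsHomogeneous.sum _ _ _ fun j _ => by
      simpa using (MvPolynomial.isHomogeneous_C (Fin 2) (g j i)).mul
        (MvPolynomial.isHomogeneous_X ℂ j))
  rw [one_mul] at this
  exact this

/-- The space of `spinRep k`: homogeneous polynomials of degree `k` in two variables. -/
abbrev SpinSpace (k : ℕ) : Type := MvPolynomial.homogeneousSubmodule (Fin 2) ℂ k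

/-- The representation `V^{k/2}` of spin `k/2` of `SU(2)`, of dimension `k + 1`: the `k`-th
symmetric power of the fundamental representation, realized on homogeneous polynomials of
degree `k` in two variables. -/
def spinRep (k : ℕ) : Representation ℂ SU2 (SpinSpace k) where
  toFun g := (linSubst g.1).toLinearMap.restrict fun _ hp => linSubst_mem g.1 k hp
  map_one' := by
    ext p : 2
    simp [linSubst_one]
  map_mul' g h := by
    ext p : 2
    simp [linSubst_mul]
    rfl

/-- The space `(V^{1/2})^{⊗ N}`, the tensor product of `N` spins `1/2`. -/
abbrev QubitSpace (N : ℕ) : Type := PiTensorProduct ℂ fun _ : Fin N => SpinSpace 1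

/-- The tensor product `(V^{1/2})^{⊗ N}` of `N` spins `1/2`, with `SU(2)` acting diagonally. -/
def qubitRep (N : ℕ) :
    Representation ℂ SU2 (QubitSpace N) where
  toFun g := PiTensorProduct.map fun _ => spinRep 1 g
  map_one' := by
    simp only [map_one]
    exact PiTensorProduct.map_one
  map_mul' g h := by
    simp only [map_mul]
    exact PiTensorProduct.map_mul _ _

/-- The numbers `m k` are the degeneracies (multiplicities) of the spins `k/2`, `k = 0, 1, 2, …`,
in a decomposition of `ρ` into spin representations: `ρ` is equivalent to the direct sum over all
`k` of `m k` copies of `V^{k/2}`. -/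
def IsSpinDecomposition {W : Type} [AddCommMonoid W] [Module ℂ W] (ρ : Representation ℂ SU2 W)
    (m : ℕ → ℕ) : Prop :=
  Nonempty (ρ.Equiv (Representation.directSum fun p : (Σ k : ℕ, Fin (m k)) => spinRep p.1))

/-- The dimension `N` of the space of intertwiners between `2n` spins `1/2`, i.e. of the subspace
of `SU(2)`-invariant vectors of `(V^{1/2})^{⊗ 2n}`. -/
def intertwinerDim (n : ℕ) : ℕ :=
  Module.finrank ℂ (Representation.invariants (k := ℂ) (G := SU2) (V := QubitSpace (2 * n)) (qubitRep (2 * n)))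

end

/-!
The decomposition of `(V^{1/2})^{⊗ N}` is found by adding one spin at a time. The Clebsch-Gordan
rule `V^{1/2} ⊗ V^{k/2} ≅ V^{(k+1)/2} ⊕ V^{(k-1)/2}`, without the second summand for `k = 0`, says
that a summand of spin `k/2` branches in the same way as a walker who stands at `k/2` and obeys the
mirror. So the copies of `V^{k/2}` satisfy the same recursion in `N` as the mirror walks that end at
`k/2` (`exists_qubitRep_equiv_pi`). In terms of polynomials the Clebsch-Gordan isomorphism
(`clebschGordan`) sends `x_0 ⊗ p + x_1 ⊗ q` to `x_0 p + x_1 q` and `∂p/∂x_1 - ∂q/∂x_0`; Euler's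
identity for homogeneous polynomials inverts it.

Multiplicities are unique (`IsSpinDecomposition.unique`) because they are determined by the
dimensions of the weight spaces: the weight `w ≥ 0` occurs in `V^{k/2}` for `k = w, w + 2, …`, once
in each, so the multiplicity of `V^{w/2}` is the difference of the dimensions for the weights `w`
and `w + 2`. Weights are read off from one diagonal matrix, with eigenvalues `exp (± i)`; the
phases `exp (i w)` of different weights are distinct since `π` is irrational.

Only the spin `0` has nonzero invariant vectors (`eq_zero_of_spinRep_invariant`), so the dimension
of the intertwiner space is the number of mirror walks that return to `0`. The reflection principle
(`mirrorWalkReturns_add`) is proved by induction on the number of steps, the symmetry of the free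
walk supplying the identity at the mirror; the free walk is counted by binomial coefficients because
of Pascal's rule. The asymptotics are Stirling's formula.
-/

noncomputable section

/-! ### Counting walks -/

theorem walkPos_snoc_of_le {N : ℕ} (ε : Fin N → ℤˣ) (s : ℤˣ) {k : ℕ} (hk : k ≤ N) :
    walkPos (Fin.snoc ε s : Fin (N + 1) → ℤˣ) k = walkPos ε k := by
  simp [walkPos, Finset.sum_filter, Fin.sum_univ_castSucc, hk]

theorem walkPos_snoc {N : ℕ} (ε : Fin N → ℤˣ) (s : ℤˣ) :
    walkPos (Fin.snoc ε s : Fin (N + 1) → ℤˣ) (N + 1) = walkPos ε N + ((s : ℤ) : ℚ) / 2 := by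
  simp [walkPos, Finset.sum_filter, Fin.sum_univ_castSucc]

theorem obeysMirror_snoc {N : ℕ} (ε : Fin N → ℤˣ) (s : ℤˣ) :
    ObeysMirror (Fin.snoc ε s : Fin (N + 1) → ℤˣ) ↔
      ObeysMirror ε ∧ (walkPos ε N = 0 → s = 1) := by
  simp [ObeysMirror, Fin.forall_fin_succ', walkPos_snoc_of_le, fun i : Fin N => i.2.le]

/-- Sorting walks by their last step. -/
theorem card_walks_succ {N : ℕ} (P : (Fin (N + 1) → ℤˣ) → Prop) :
    Nat.card {ε // P ε} = Nat.card {ε : Fin N → ℤˣ // P (Fin.snoc ε 1)} +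
      Nat.card {ε : Fin N → ℤˣ // P (Fin.snoc ε (-1))} := by
  classical
  have e : {ε // P ε} ≃ (s : ℤˣ) × {ε : Fin N → ℤˣ // P (Fin.snoc ε s)} :=
    (((Fin.snocEquiv fun _ => ℤˣ).subtypeEquivOfSubtype.symm).trans
      (Equiv.subtypeProdEquivSigmaSubtype fun s ε => P (Fin.snoc ε s)))
  rw [Nat.card_congr e, Nat.card_sigma]
  rfl

/-- The last step of a walk leads to `x` from `x - 1/2` or from `x + 1/2`. -/
theorem walkReturns_succ (N : ℕ) (x : ℚ) :
    walkReturns (N + 1) x = walkReturns N (x - 1 / 2) + walkReturns N (x + 1 / 2) := by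
  simp only [walkReturns, card_walks_succ, walkPos_snoc]
  congr! 4 with ε ε
  · push_cast; constructor <;> intro h <;> linarith
  · push_cast; constructor <;> intro h <;> linarith

/-- With the mirror, the last step cannot lead from `0` to `-1/2`. -/
theorem mirrorWalkReturns_succ (N : ℕ) (x : ℚ) :
    mirrorWalkReturns (N + 1) x = mirrorWalkReturns N (x - 1 / 2) +
      if x = -1 / 2 then 0 else mirrorWalkReturns N (x + 1 / 2) := by
  simp only [mirrorWalkReturns, card_walks_succ, walkPos_snoc, obeysMirror_snoc]
  congr 1
  · congr! 3 with ε
    push_cast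
    simp only [implies_true, and_true]
    refine and_congr_right fun _ => ?_
    constructor <;> intro h <;> linarith
  · split_ifs with hx
    · have : IsEmpty {ε : Fin N → ℤˣ // (ObeysMirror ε ∧ (walkPos ε N = 0 → (-1 : ℤˣ) = 1)) ∧
          walkPos ε N + (((-1 : ℤˣ) : ℤ) : ℚ) / 2 = x} := by
        refine ⟨fun ε => ?_⟩
        have h := ε.2.2
        have := ε.2.1.2 (by push_cast at h; linarith)
        exact absurd this (by decide)
      rw [Nat.card_of_isEmpty]
    · congr! 3 with ε
      push_cast
      constructor
      · rintro ⟨⟨h, -⟩, h'⟩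
        exact ⟨h, by linarith⟩
      · rintro ⟨h, h'⟩
        refine ⟨⟨h, fun h0 => absurd ?_ hx⟩, by linarith⟩
        linarith

theorem walkReturns_zero (x : ℚ) : walkReturns 0 x = if x = 0 then 1 else 0 := by
  split_ifs with h <;> simp [walkReturns, walkPos, h, eq_comm (a := (0 : ℚ))]

theorem mirrorWalkReturns_zero (x : ℚ) : mirrorWalkReturns 0 x = if x = 0 then 1 else 0 := by
  split_ifs with h <;>
    simp [mirrorWalkReturns, ObeysMirror, walkPos, h, eq_comm (a := (0 : ℚ))]

theorem walkReturns_neg (N : ℕ) (x : ℚ) : walkReturns N (-x) = walkReturns N x := by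
  induction N generalizing x with
  | zero => simp [walkReturns_zero]
  | succ N ih =>
    rw [walkReturns_succ, walkReturns_succ, add_comm, ← ih (x - 1 / 2), ← ih (x + 1 / 2)]
    congr 2 <;> ring

theorem mirrorWalkReturns_of_neg (N : ℕ) {h : ℤ} (hh : h < 0) :
    mirrorWalkReturns N ((h : ℚ) / 2) = 0 := by
  induction N generalizing h with
  | zero => simp [mirrorWalkReturns_zero, hh.ne]
  | succ N ih =>
    rw [mirrorWalkReturns_succ, show (h : ℚ) / 2 - 1 / 2 = ((h - 1 : ℤ) : ℚ) / 2 by push_cast; ring,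
      show (h : ℚ) / 2 + 1 / 2 = ((h + 1 : ℤ) : ℚ) / 2 by push_cast; ring, ih (by omega)]
    split_ifs with h1
    · rfl
    · have : h ≠ -1 := by rintro rfl; exact h1 (by norm_num)
      rw [ih (by omega)]

theorem mirrorWalkReturns_succ_nat (N k : ℕ) :
    mirrorWalkReturns (N + 1) ((k : ℚ) / 2) = mirrorWalkReturns N (((k : ℚ) - 1) / 2) +
      mirrorWalkReturns N (((k : ℚ) + 1) / 2) := by
  rw [mirrorWalkReturns_succ, if_neg, sub_div, add_div]
  have : (0 : ℚ) ≤ k := k.cast_nonneg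
  linarith

/-- The **reflection principle**: the walks to `k/2` that violate the mirror are as many as all
walks to `k/2 + 1`. -/
theorem mirrorWalkReturns_add (N : ℕ) (k : ℕ) :
    mirrorWalkReturns N ((k : ℚ) / 2) + walkReturns N ((k : ℚ) / 2 + 1) =
      walkReturns N ((k : ℚ) / 2) := by
  induction N generalizing k with
  | zero =>
    have : (k : ℚ) / 2 + 1 ≠ 0 := by positivity
    simp [mirrorWalkReturns_zero, walkReturns_zero, this]
  | succ N ih =>
    have h1 := ih (k + 1)
    -- At the mirror the identity for `k - 1` is the symmetry of the walk without mirror.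
    have h2 : mirrorWalkReturns N (((k : ℚ) - 1) / 2) + walkReturns N (((k : ℚ) - 1) / 2 + 1) =
        walkReturns N (((k : ℚ) - 1) / 2) := by
      rcases k with _ | k
      · have := mirrorWalkReturns_of_neg N (h := -1) (by norm_num)
        rw [← walkReturns_neg N (_ + 1)]
        norm_num at this ⊢
        exact this
      · simpa using ih k
    rw [mirrorWalkReturns_succ_nat, walkReturns_succ, walkReturns_succ]
    push_cast at h1
    rw [show (k : ℚ) / 2 + 1 - 1 / 2 = (k - 1) / 2 + 1 by ring,
      show (k : ℚ) / 2 + 1 + 1 / 2 = (k + 1) / 2 + 1 by ring,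
      show (k : ℚ) / 2 - 1 / 2 = (k - 1) / 2 by ring,
      show (k : ℚ) / 2 + 1 / 2 = (k + 1) / 2 by ring]
    omega

theorem walkReturns_eq_zero_of_lt (N : ℕ) {x : ℚ} (hx : (N : ℚ) / 2 < x) : walkReturns N x = 0 := by
  induction N generalizing x with
  | zero => rw [walkReturns_zero, if_neg]; rintro rfl; simp at hx
  | succ N ih => push_cast at hx; rw [walkReturns_succ, ih (by linarith), ih (by linarith)]

/-- A walk with `i` steps up among `N` ends at `i - N / 2`. -/
theorem walkReturns_eq_choose (N i : ℕ) : walkReturns N ((i : ℚ) - (N : ℚ) / 2) = N.choose i := by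
  induction N generalizing i with
  | zero => rcases i with _ | i <;> simp [walkReturns_zero]; positivity
  | succ N ih =>
    rw [walkReturns_succ]
    rcases i with _ | i
    · have h0 := ih 0
      rw [Nat.choose_zero_right] at h0 ⊢
      rw [← walkReturns_neg N (_ - 1 / 2), walkReturns_eq_zero_of_lt, zero_add]
      · refine Eq.trans ?_ h0
        congr 1; push_cast; ring
      · push_cast; linarith
    · rw [Nat.choose_succ_succ, ← ih, ← ih]
      congr 2 <;> push_cast <;> ring

theorem walkReturns_two_mul (n j : ℕ) : walkReturns (2 * n) (j : ℚ) = (2 * n).choose (n + j) := by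
  rw [← walkReturns_eq_choose]
  congr 1
  push_cast
  ring

theorem mirrorWalkReturns_two_mul (n j : ℕ) :
    (mirrorWalkReturns (2 * n) (j : ℚ) : ℤ) =
      ((2 * n).choose (n + j) : ℤ) - ((2 * n).choose (n + j + 1) : ℤ) := by
  have := mirrorWalkReturns_add (2 * n) (2 * j)
  rw [show ((2 * j : ℕ) : ℚ) / 2 = j by push_cast; ring,
    show (j : ℚ) + 1 = ((j + 1 : ℕ) : ℚ) by push_cast; ring, walkReturns_two_mul,
    walkReturns_two_mul, ← add_assoc] at this
  omega

theorem mirrorWalkReturns_two_mul_zero (n : ℕ) : mirrorWalkReturns (2 * n) 0 = catalan n := by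
  have h := mirrorWalkReturns_two_mul n 0
  have h2 := Nat.choose_succ_right_eq (2 * n) n
  have h3 := succ_mul_catalan_eq_centralBinom n
  rw [Nat.centralBinom] at h3
  rw [show 2 * n - n = n by omega] at h2
  rw [Nat.cast_zero] at h
  have : (n + 1) * mirrorWalkReturns (2 * n) 0 = (n + 1) * catalan n := by
    rw [h3]
    zify at h2 ⊢
    rw [h, add_zero]
    linarith
  exact Nat.eq_of_mul_eq_mul_left n.succ_pos this

/-! ### Asymptotics of the Catalan numbers -/

/-- The logarithmic form of `catalan n ∼ 4 ^ n / (√π n ^ (3/2))`. The Stirling sequence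
`s n = n! / (√(2n) (n/e)^n)` tends to `√π`, and `catalan n` is
`4 ^ n / √n * s (2n) / (s n) ^ 2 / (n + 1)`. -/
theorem tendsto_log_catalan :
    Tendsto (fun n : ℕ => Real.log (catalan n : ℝ) -
      (2 * (n : ℝ) * Real.log 2 - 3 / 2 * Real.log (n : ℝ) - 1 / 2 * Real.log Real.pi))
      atTop (𝓝 0) := by
  have hs : Tendsto (fun n => Real.log (Stirling.stirlingSeq n)) atTop
      (𝓝 (1 / 2 * Real.log Real.pi)) := by
    have := Stirling.tendsto_stirlingSeq_sqrt_pi.log (by positivity)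
    rwa [Real.log_sqrt Real.pi_pos.le, div_eq_inv_mul, ← one_div] at this
  have hs2 := hs.comp (tendsto_id.const_mul_atTop' two_pos)
  have hq : Tendsto (fun n : ℕ => Real.log ((n : ℝ) / (n + 1))) atTop (𝓝 0) := by
    simpa using (tendsto_natCast_div_add_atTop (1 : ℝ)).log one_ne_zero
  have := ((hs2.sub (hs.const_mul 2)).add hq).add_const (1 / 2 * Real.log Real.pi)
  rw [show 1 / 2 * Real.log Real.pi - 2 * (1 / 2 * Real.log Real.pi) + 0 +
    1 / 2 * Real.log Real.pi = 0 by ring] at this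
  refine this.congr' ?_
  filter_upwards [eventually_ge_atTop 1] with n hn
  have hn0 : (n : ℝ) ≠ 0 := by positivity
  have hc : (catalan n : ℝ) = ((2 * n).factorial : ℝ) / (n.factorial * n.factorial) / (n + 1) := by
    have h := succ_mul_catalan_eq_centralBinom n
    have h' := Nat.choose_mul_factorial_mul_factorial (show n ≤ 2 * n by omega)
    rw [show 2 * n - n = n by omega] at h'
    rw [Nat.centralBinom] at h
    rw [← h', ← h]
    push_cast
    field_simp
  have hf : ∀ n : ℕ, (n.factorial : ℝ) ≠ 0 := fun n => by positivity
  rw [hc, Real.log_div (div_ne_zero (hf _) (mul_ne_zero (hf _) (hf _))) (by positivity),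
    Real.log_div (hf _) (mul_ne_zero (hf _) (hf _)), Real.log_mul (hf _) (hf _),
    Real.log_div hn0 (by positivity)]
  simp only [Function.comp, id, Stirling.log_stirlingSeq_formula]
  push_cast
  rw [Real.log_mul two_ne_zero (by positivity), Real.log_mul two_ne_zero hn0,
    Real.log_div (by positivity) (Real.exp_ne_zero _), Real.log_div hn0 (Real.exp_ne_zero _),
    Real.log_mul two_ne_zero hn0, Real.log_exp]
  ring

open MvPolynomial

/-! ### Products of representations -/

namespace Representation

variable {G : Type*} [Monoid G] {ι κ : Type*} {V : ι → Type*} [∀ i, AddCommMonoid (V i)]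
  [∀ i, Module ℂ (V i)]

/-- The componentwise representation on a product of representations. -/
def pi (ρ : ∀ i, Representation ℂ G (V i)) : Representation ℂ G (∀ i, V i) where
  toFun g := LinearMap.pi fun i => ρ i g ∘ₗ LinearMap.proj i
  map_one' := by ext; simp
  map_mul' g h := by ext; simp

@[simp]
theorem pi_apply (ρ : ∀ i, Representation ℂ G (V i)) (g : G) (v : ∀ i, V i) (i : ι) :
    pi ρ g v i = ρ i g (v i) := rfl

/-- Componentwise equivalent families have equivalent products. -/
def piCongrRight {W : ι → Type*} [∀ i, AddCommMonoid (W i)] [∀ i, Module ℂ (W i)]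
    {ρ : ∀ i, Representation ℂ G (V i)} {σ : ∀ i, Representation ℂ G (W i)}
    (e : ∀ i, (ρ i).Equiv (σ i)) : (pi ρ).Equiv (pi σ) :=
  .mk (LinearEquiv.piCongrRight fun i => (e i).toLinearEquiv) fun g => by
    ext v i
    exact LinearMap.congr_fun ((e i).isIntertwining' g) (v i)

/-- Reindexing a product of representations. -/
def piCongrLeft (e : κ ≃ ι) (ρ : ∀ i, Representation ℂ G (V i)) :
    (pi ρ).Equiv (pi fun k => ρ (e k)) :=
  .mk (LinearEquiv.piCongrLeft ℂ V e).symm fun g => by ext v i; rfl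

/-- A product over a sigma type as an iterated product. -/
def piCurry {κ : ι → Type*} {V : ∀ i, κ i → Type*} [∀ i k, AddCommMonoid (V i k)]
    [∀ i k, Module ℂ (V i k)] (ρ : ∀ i k, Representation ℂ G (V i k)) :
    (pi fun p : Sigma κ => ρ p.1 p.2).Equiv (pi fun i => pi (ρ i)) :=
  .mk (LinearEquiv.piCurry ℂ V) fun g => by ext v i; rfl

/-- A finite direct sum of representations is their product. -/
def directSumEquivPi [Fintype ι] [DecidableEq ι] (ρ : ∀ i, Representation ℂ G (V i)) :
    (directSum ρ).Equiv (pi ρ) :=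
  .mk (DirectSum.linearEquivFunOnFintype ℂ ι V) fun g => by
    ext i v j
    by_cases h : i = j
    · subst h; simp
    · simp [DirectSum.lof_eq_of, DirectSum.of_eq_of_ne _ _ _ (Ne.symm h)]

end Representation

open Representation

/-! ### Tensoring with a spin `1/2` -/

section HalfTensor

variable {W W' : Type*} [AddCommMonoid W] [Module ℂ W] [AddCommMonoid W'] [Module ℂ W']

/-- The tensor product `V^{1/2} ⊗ W`, modelled on `W × W` by writing its elements as
`x_0 ⊗ w 0 + x_1 ⊗ w 1` with `x_0, x_1` the standard basis of `V^{1/2} = ℂ²`. -/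
def halfTensor (ρ : Representation ℂ SU2 W) : Representation ℂ SU2 (Fin 2 → W) where
  toFun g := LinearMap.pi fun j => ∑ i, g.1 j i • (ρ g ∘ₗ LinearMap.proj i)
  map_one' := by
    ext i w j
    fin_cases i <;> fin_cases j <;> simp
  map_mul' g h := by
    refine LinearMap.ext fun w => funext fun j => ?_
    simp [Matrix.mul_apply, Fin.sum_univ_two]
    module

theorem halfTensor_apply (ρ : Representation ℂ SU2 W) (g : SU2) (w : Fin 2 → W) (j : Fin 2) :
    halfTensor ρ g w j = g.1 j 0 • ρ g (w 0) + g.1 j 1 • ρ g (w 1) := by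
  simp [halfTensor, Fin.sum_univ_two]

/-- Tensoring with `V^{1/2}` preserves equivalence. -/
def halfTensorCongr {ρ : Representation ℂ SU2 W} {σ : Representation ℂ SU2 W'} (e : ρ.Equiv σ) :
    (halfTensor ρ).Equiv (halfTensor σ) :=
  .mk (LinearEquiv.piCongrRight fun _ => e.toLinearEquiv) fun g => by
    have he : ∀ w, e (ρ g w) = σ g (e w) :=
      LinearMap.congr_fun (e.isIntertwining' g)
    refine LinearMap.ext fun w => funext fun j => ?_
    simp [halfTensor_apply, he]

/-- Tensoring with `V^{1/2}` distributes over products. -/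
def halfTensorPi {ι : Type*} {V : ι → Type*} [∀ i, AddCommMonoid (V i)] [∀ i, Module ℂ (V i)]
    (ρ : ∀ i, Representation ℂ SU2 (V i)) :
    (halfTensor (pi ρ)).Equiv (pi fun i => halfTensor (ρ i)) :=
  .mk { toFun := fun w i j => w j i
        invFun := fun w j i => w i j
        map_add' := fun _ _ => rfl
        map_smul' := fun _ _ => rfl } fun g => by
    refine LinearMap.ext fun w => funext fun i => funext fun j => ?_
    simp [halfTensor_apply]

end HalfTensor

/-! ### Splitting off one factor of the tensor power -/

section QubitSplit

/-- The coordinate vectors `x_0, x_1` of the spin `1/2` representation. -/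
def spinX (i : Fin 2) : SpinSpace 1 := ⟨X i, isHomogeneous_X ℂ i⟩

theorem spinRep_spinX (g : SU2) (i : Fin 2) :
    spinRep 1 g (spinX i) = g.1 0 i • spinX 0 + g.1 1 i • spinX 1 := by
  apply Subtype.ext
  simp [spinRep, spinX, linSubst, Fin.sum_univ_two, smul_eq_C_mul]

/-- The `i`-th coordinate of a linear form. -/
def spinCoord (i : Fin 2) : SpinSpace 1 →ₗ[ℂ] ℂ :=
  (lcoeff ℂ (Finsupp.single i 1)).comp (Submodule.subtype _)

theorem spinCoord_spinX (i j : Fin 2) : spinCoord i (spinX j) = if j = i then 1 else 0 := by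
  simp [spinCoord, spinX, coeff_X, Finsupp.single_left_inj]

theorem spinCoord_sum (v : SpinSpace 1) :
    spinCoord 0 v • spinX 0 + spinCoord 1 v • spinX 1 = v := by
  have hv : v.1 ∈ Submodule.span ℂ (Set.range (X : Fin 2 → MvPolynomial (Fin 2) ℂ)) :=
    homogeneousSubmodule_one_eq_span_X (σ := Fin 2) (R := ℂ) ▸ v.2
  obtain ⟨c, hc⟩ := (Submodule.mem_span_range_iff_exists_fun ℂ).1 hv
  have hc' : v = c 0 • spinX 0 + c 1 • spinX 1 := by
    apply Subtype.ext
    rw [← hc]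
    simp [spinX, Fin.sum_univ_two]
  rw [hc']
  simp [spinCoord_spinX]

/-- Prepending a factor to a pure tensor. -/
def tensorCons (N : ℕ) (v : SpinSpace 1) : QubitSpace N →ₗ[ℂ] QubitSpace (N + 1) :=
  PiTensorProduct.lift
    ((PiTensorProduct.tprod ℂ (s := fun _ : Fin (N + 1) => SpinSpace 1)).curryLeft v)

theorem tensorCons_tprod (N : ℕ) (v : SpinSpace 1) (m : Fin N → SpinSpace 1) :
    tensorCons N v (PiTensorProduct.tprod ℂ m) =
      PiTensorProduct.tprod ℂ (Fin.cons v m : Fin (N + 1) → SpinSpace 1) := by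
  simp [tensorCons]

theorem tensorCons_combination (N : ℕ) (a b : ℂ) (v w : SpinSpace 1) (t : QubitSpace N) :
    tensorCons N (a • v + b • w) t = a • tensorCons N v t + b • tensorCons N w t := by
  simp [tensorCons]

/-- The two components `w` of a tensor `x_0 ⊗ w 0 + x_1 ⊗ w 1`, its first factor being
expanded in the basis `x_0, x_1`. -/
def tensorUncons (N : ℕ) : QubitSpace (N + 1) →ₗ[ℂ] (Fin 2 → QubitSpace N) :=
  LinearMap.pi fun i => PiTensorProduct.lift (LinearMap.uncurryLeft
    (LinearMap.toSpanSingleton ℂ _ (PiTensorProduct.tprod ℂ (s := fun _ : Fin N => SpinSpace 1))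
      ∘ₗ spinCoord i))

theorem tensorUncons_tprod (N : ℕ) (m : Fin (N + 1) → SpinSpace 1) (i : Fin 2) :
    tensorUncons N (PiTensorProduct.tprod ℂ m) i =
      spinCoord i (m 0) • PiTensorProduct.tprod ℂ (Fin.tail m) := by
  simp [tensorUncons]

/-- The linear isomorphism `w ↦ x_0 ⊗ w 0 + x_1 ⊗ w 1` underlying `qubitSplit`. -/
def qubitSplitLinear (N : ℕ) : (Fin 2 → QubitSpace N) ≃ₗ[ℂ] QubitSpace (N + 1) :=
  LinearEquiv.ofLinearMap (∑ i, tensorCons N (spinX i) ∘ₗ LinearMap.proj i) (tensorUncons N)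
    (by
      refine PiTensorProduct.ext (MultilinearMap.ext fun m => ?_)
      simp only [Fin.sum_univ_two, LinearMap.compMultilinearMap_apply, LinearMap.comp_apply,
        LinearMap.add_apply, LinearMap.proj_apply, tensorUncons_tprod, map_smul]
      rw [← tensorCons_combination, spinCoord_sum, tensorCons_tprod, Fin.cons_self_tail]
      rfl)
    (by
      refine LinearMap.pi_ext' fun j => PiTensorProduct.ext (MultilinearMap.ext fun m => ?_)
      funext i
      fin_cases j <;> fin_cases i <;>
        simp [tensorCons_tprod, tensorUncons_tprod, spinCoord_spinX])

theorem qubitSplitLinear_apply (N : ℕ) (w : Fin 2 → QubitSpace N) :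
    qubitSplitLinear N w = tensorCons N (spinX 0) (w 0) + tensorCons N (spinX 1) (w 1) := by
  simp [qubitSplitLinear, Fin.sum_univ_two]

theorem qubitRep_tensorCons (N : ℕ) (g : SU2) (v : SpinSpace 1) (t : QubitSpace N) :
    qubitRep (N + 1) g (tensorCons N v t) = tensorCons N (spinRep 1 g v) (qubitRep N g t) := by
  refine LinearMap.congr_fun (f := qubitRep (N + 1) g ∘ₗ tensorCons N v)
    (g := tensorCons N (spinRep 1 g v) ∘ₗ qubitRep N g)
    (PiTensorProduct.ext (MultilinearMap.ext fun m => ?_)) t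
  simp only [LinearMap.compMultilinearMap_apply, LinearMap.comp_apply, tensorCons_tprod, qubitRep,
    MonoidHom.coe_mk, OneHom.coe_mk, PiTensorProduct.map_tprod]
  congr 1
  funext i
  refine Fin.cases ?_ (fun i => ?_) i <;> simp

/-- Splitting off the first of `N + 1` spins. -/
def qubitSplit (N : ℕ) : (halfTensor (qubitRep N)).Equiv (qubitRep (N + 1)) :=
  .mk (qubitSplitLinear N) fun g => by
    refine LinearMap.ext fun w => ?_
    simp only [LinearMap.comp_apply, LinearEquiv.coe_coe, qubitSplitLinear_apply, map_add,
      qubitRep_tensorCons, spinRep_spinX, tensorCons_combination, halfTensor_apply, map_smul]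
    abel

end QubitSplit

/-! ### Linear substitutions and derivatives -/

theorem spinRep_coe (k : ℕ) (g : SU2) (p : SpinSpace k) :
    (spinRep k g p : MvPolynomial (Fin 2) ℂ) = linSubst g.1 p.1 := rfl

theorem linSubst_X (g : Matrix (Fin 2) (Fin 2) ℂ) (i : Fin 2) :
    linSubst g (X i) = C (g 0 i) * X 0 + C (g 1 i) * X 1 := by
  simp [linSubst, Fin.sum_univ_two]

/-- The chain rule for a linear substitution. -/
theorem pderiv_linSubst (g : Matrix (Fin 2) (Fin 2) ℂ) (j : Fin 2) (p : MvPolynomial (Fin 2) ℂ) :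
    pderiv j (linSubst g p) =
      C (g j 0) * linSubst g (pderiv 0 p) + C (g j 1) * linSubst g (pderiv 1 p) := by
  induction p using MvPolynomial.induction_on with
  | C a => simp [linSubst]
  | add p q hp hq => simp only [map_add, hp, hq]; ring
  | mul_X p i hp =>
    simp only [map_mul, linSubst_X, Derivation.leibniz, map_add, hp, smul_eq_mul, pderiv_C,
      mul_zero]
    fin_cases i <;> fin_cases j <;> simp <;> ring

theorem pderiv_pderiv_comm (p : MvPolynomial (Fin 2) ℂ) :
    pderiv 0 (pderiv 1 p) = pderiv 1 (pderiv 0 p) := by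
  induction p using MvPolynomial.induction_on with
  | C a => simp
  | add p q hp hq => simp only [map_add, hp, hq]
  | mul_X p i hp =>
    fin_cases i <;> simp [hp, add_comm]

theorem euler_identity {k : ℕ} {p : MvPolynomial (Fin 2) ℂ} (hp : p.IsHomogeneous k) :
    X 0 * pderiv 0 p + X 1 * pderiv 1 p = C (k : ℂ) * p := by
  have := hp.sum_X_mul_pderiv
  rwa [Fin.sum_univ_two, nsmul_eq_mul, ← map_natCast (C : ℂ →+* _)] at this

/-- The space of spin `0` consists of the constant polynomials. -/
theorem exists_eq_C_of_spinSpace_zero (p : SpinSpace 0) :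
    ∃ c : ℂ, (p : MvPolynomial (Fin 2) ℂ) = C c := by
  have := p.2
  rw [mem_homogeneousSubmodule, ← totalDegree_zero_iff_isHomogeneous,
    totalDegree_eq_zero_iff_eq_C] at this
  exact ⟨_, this⟩

/-! ### The Clebsch-Gordan decomposition -/

section ClebschGordan

/-- The spins (doubled) occurring in `V^{1/2} ⊗ V^{k/2}`. -/
abbrev SpinNeighbour (k : ℕ) : Type := {l : ℕ // l = k + 1 ∨ l + 1 = k}

theorem clebschGordan_mem {k : ℕ} (l : SpinNeighbour k) (w : Fin 2 → SpinSpace k) :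
    (if l.1 = k + 1 then X 0 * (w 0).1 + X 1 * (w 1).1
      else pderiv 1 (w 0).1 - pderiv 0 (w 1).1) ∈ homogeneousSubmodule (Fin 2) ℂ l.1 := by
  split_ifs with h
  · rw [h, add_comm k]
    exact add_mem ((isHomogeneous_X ℂ 0).mul (w 0).2) ((isHomogeneous_X ℂ 1).mul (w 1).2)
  · have : l.1 = k - 1 := by have := l.2; omega
    rw [this]
    exact sub_mem (IsHomogeneous.pderiv (w 0).2) (IsHomogeneous.pderiv (w 1).2)

/-- The Clebsch-Gordan map: multiplication `x ⊗ p ↦ x p` onto `V^{(k+1)/2}`, and the contraction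
`x_0 ⊗ p + x_1 ⊗ q ↦ ∂p/∂x_1 - ∂q/∂x_0` onto `V^{(k-1)/2}`. -/
def clebschGordanMap (k : ℕ) :
    (Fin 2 → SpinSpace k) →ₗ[ℂ] ∀ l : SpinNeighbour k, SpinSpace l.1 where
  toFun w l := ⟨_, clebschGordan_mem l w⟩
  map_add' v w := by
    funext l
    apply Subtype.ext
    by_cases h : l.1 = k + 1 <;> simp [h] <;> ring
  map_smul' c w := by
    funext l
    apply Subtype.ext
    by_cases h : l.1 = k + 1 <;> simp [h, smul_add, smul_sub]

theorem clebschGordanMap_up {k : ℕ} (w : Fin 2 → SpinSpace k) (l : SpinNeighbour k)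
    (h : l.1 = k + 1) :
    (clebschGordanMap k w l).1 = X 0 * (w 0).1 + X 1 * (w 1).1 := if_pos h

theorem clebschGordanMap_down {k : ℕ} (w : Fin 2 → SpinSpace k) (l : SpinNeighbour k)
    (h : l.1 + 1 = k) :
    (clebschGordanMap k w l).1 = pderiv 1 (w 0).1 - pderiv 0 (w 1).1 := if_neg (by omega)

/-- If `x_0 p + x_1 q = 0` and `∂p/∂x_1 = ∂q/∂x_0`, differentiating the first equation and Euler's
identity give `(k + 1) p = (k + 1) q = 0`. -/
theorem clebschGordanMap_injective (k : ℕ) : Function.Injective (clebschGordanMap k) := by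
  rw [← LinearMap.ker_eq_bot, LinearMap.ker_eq_bot']
  intro w hw
  have hup : X 0 * (w 0).1 + X 1 * (w 1).1 = 0 := by
    rw [← clebschGordanMap_up w ⟨k + 1, .inl rfl⟩ rfl, hw]; rfl
  have hdown : pderiv 1 (w 0).1 = pderiv 0 (w 1).1 := by
    rcases k with _ | k
    · -- both sides are derivatives of constants
      have h : ∀ i j, pderiv i (w j).1 = 0 := fun i j => by
        obtain ⟨c, hc⟩ := exists_eq_C_of_spinSpace_zero (w j)
        rw [hc, pderiv_C]
      rw [h, h]
    · rw [← sub_eq_zero, ← clebschGordanMap_down w ⟨k, .inr rfl⟩ rfl, hw]; rfl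
  have hk : (C ((k : ℂ) + 1) : MvPolynomial (Fin 2) ℂ) ≠ 0 := by
    rw [Ne, C_eq_zero]; exact Nat.cast_add_one_ne_zero k
  have e0 := euler_identity (w 0).2
  have e1 := euler_identity (w 1).2
  have d0 := congrArg (pderiv 0) hup
  have d1 := congrArg (pderiv 1) hup
  simp only [map_add, Derivation.leibniz, pderiv_X_self, smul_eq_mul, map_zero, mul_one,
    pderiv_X_of_ne (show (1 : Fin 2) ≠ 0 by decide),
    pderiv_X_of_ne (show (0 : Fin 2) ≠ 1 by decide)] at d0 d1
  funext i
  apply Subtype.ext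
  refine (mul_eq_zero.1 (?_ : C ((k : ℂ) + 1) * (w i).1 = 0)).resolve_left hk
  rw [C_add, C_1]
  fin_cases i
  · simp only [Fin.zero_eta]
    linear_combination d0 - e0 + X 1 * hdown
  · simp only [Fin.mk_one]
    linear_combination d1 - e1 - X 0 * hdown

theorem clebschGordanMap_surjective (k : ℕ) : Function.Surjective (clebschGordanMap k) := by
  intro v
  set p := v ⟨k + 1, .inl rfl⟩ with hp
  -- `q` is the component in `V^{(k-1)/2}`, read as `0` if `k = 0`
  obtain ⟨q, hq, hqk, hqX⟩ : ∃ q : MvPolynomial (Fin 2) ℂ,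
      (∀ l : SpinNeighbour k, l.1 + 1 = k → (v l).1 = q) ∧ (∀ i, (X i * q).IsHomogeneous k) ∧
      X 0 * pderiv 0 q + X 1 * pderiv 1 q + q = C (k : ℂ) * q := by
    rcases k with _ | k
    · exact ⟨0, fun l h => absurd h (by omega),
        fun i => by simpa using isHomogeneous_zero _ _ _, by simp⟩
    · refine ⟨(v ⟨k, .inr rfl⟩).1, fun l h => ?_, fun i => ?_, ?_⟩
      · obtain ⟨l, hl⟩ := l
        obtain rfl : l = k := by simpa using h
        rfl
      · have hq : (v ⟨k, .inr rfl⟩).1.IsHomogeneous k := (v ⟨k, .inr rfl⟩).2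
        simpa only [add_comm 1 k] using (isHomogeneous_X ℂ i).mul hq
      · rw [euler_identity (v ⟨k, .inr rfl⟩).2]; push_cast; rw [C_add, C_1]; ring
  have hk : ((k : ℂ) + 1) ≠ 0 := Nat.cast_add_one_ne_zero k
  set c : ℂ := ((k : ℂ) + 1)⁻¹ with hc
  have hcC : (C c : MvPolynomial (Fin 2) ℂ) * (C (k : ℂ) + 1) = 1 := by
    rw [← C_1, ← C_add, ← C_mul, hc, inv_mul_cancel₀ hk]
  have hpe := euler_identity p.2
  rw [Nat.cast_add, Nat.cast_one, C_add, C_1] at hpe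
  -- the inverse is `p ↦ (x₀ ⊗ ∂₀p + x₁ ⊗ ∂₁p) / (k + 1)`, `q ↦ (x₀ ⊗ x₁q - x₁ ⊗ x₀q) / (k + 1)`
  let w : Fin 2 → SpinSpace k :=
    ![⟨C c * (pderiv 0 p.1 + X 1 * q), by
        rw [← smul_eq_C_mul]
        exact Submodule.smul_mem _ _ (add_mem (IsHomogeneous.pderiv p.2) (hqk 1))⟩,
      ⟨C c * (pderiv 1 p.1 - X 0 * q), by
        rw [← smul_eq_C_mul]
        exact Submodule.smul_mem _ _ (sub_mem (IsHomogeneous.pderiv p.2) (hqk 0))⟩]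
  have w0 : (w 0).1 = C c * (pderiv 0 p.1 + X 1 * q) := rfl
  have w1 : (w 1).1 = C c * (pderiv 1 p.1 - X 0 * q) := rfl
  refine ⟨w, funext fun l => Subtype.ext ?_⟩
  rcases l.2 with h | h
  · rw [clebschGordanMap_up w l h, w0, w1]
    have : (v l).1 = p.1 := by obtain ⟨l, hl⟩ := l; subst h; rfl
    rw [this]
    linear_combination C c * hpe + p.1 * hcC
  · rw [clebschGordanMap_down w l h, w0, w1, hq l h]
    simp only [map_add, map_sub, Derivation.leibniz, pderiv_X_self, smul_eq_mul, mul_one, pderiv_C,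
      mul_zero, add_zero, pderiv_pderiv_comm]
    linear_combination C c * hqX + q * hcC

theorem clebschGordanMap_bijective (k : ℕ) : Function.Bijective (clebschGordanMap k) :=
  ⟨clebschGordanMap_injective k, clebschGordanMap_surjective k⟩

/-- The **Clebsch-Gordan decomposition** `V^{1/2} ⊗ V^{k/2} ≅ V^{(k+1)/2} ⊕ V^{(k-1)/2}`, without
the second summand if `k = 0`. -/
def clebschGordan (k : ℕ) :
    (halfTensor (spinRep k)).Equiv (pi fun l : SpinNeighbour k => spinRep l.1) :=
  .mk (LinearEquiv.ofBijective (clebschGordanMap k) (clebschGordanMap_bijective k)) fun g => by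
    -- the contraction is invariant only up to the determinant, which is `1`
    have hdet : (C (g.1 0 0) * C (g.1 1 1) - C (g.1 0 1) * C (g.1 1 0) :
        MvPolynomial (Fin 2) ℂ) = 1 := by
      have := Matrix.det_fin_two g.1
      rw [(Matrix.mem_specialUnitaryGroup_iff.1 g.2).2] at this
      rw [← C_mul, ← C_mul, ← C_sub, ← this, C_1]
    refine LinearMap.ext fun w => funext fun l => Subtype.ext ?_
    change (clebschGordanMap k (halfTensor (spinRep k) g w) l).1 =
      linSubst g.1 (clebschGordanMap k w l).1
    rcases l.2 with h | h
    · rw [clebschGordanMap_up _ l h, clebschGordanMap_up _ l h]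
      simp only [halfTensor_apply, Submodule.coe_add, Submodule.coe_smul, spinRep_coe, map_add,
        map_mul, linSubst_X, smul_eq_C_mul]
      ring
    · rw [clebschGordanMap_down _ l h, clebschGordanMap_down _ l h]
      simp only [halfTensor_apply, Submodule.coe_add, Submodule.coe_smul, spinRep_coe, map_add,
        map_sub, smul_eq_C_mul, pderiv_C_mul, pderiv_linSubst]
      linear_combination (linSubst g.1 (pderiv 1 (w 0).1) - linSubst g.1 (pderiv 0 (w 1).1)) * hdet

end ClebschGordan

/-! ### Decomposition of the tensor power -/

section Existence

/-- The scalars as the space of spin `0`. -/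
def spinZeroEquiv : ℂ ≃ₗ[ℂ] SpinSpace 0 where
  toFun c := ⟨C c, isHomogeneous_C _ c⟩
  invFun p := constantCoeff p.1
  map_add' a b := Subtype.ext C_add
  map_smul' a b := Subtype.ext (by simp [smul_eq_C_mul])
  left_inv c := by simp
  right_inv p := by
    obtain ⟨c, hc⟩ := exists_eq_C_of_spinSpace_zero p
    apply Subtype.ext
    simp [hc]

theorem spinRep_zero_apply (g : SU2) (p : SpinSpace 0) : spinRep 0 g p = p := by
  obtain ⟨c, hc⟩ := exists_eq_C_of_spinSpace_zero p
  apply Subtype.ext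
  rw [spinRep_coe, hc]
  simp [linSubst]

/-- The empty tensor product of spins is the trivial representation, that is, the spin `0`. -/
def qubitZero : (qubitRep 0).Equiv (pi fun _ : Unit => spinRep 0) :=
  .mk ((PiTensorProduct.isEmptyEquiv (Fin 0)).trans
    (spinZeroEquiv.trans (LinearEquiv.funUnique Unit ℂ (SpinSpace 0)).symm)) fun g => by
    refine PiTensorProduct.ext (MultilinearMap.ext fun m => funext fun _ => ?_)
    simp [qubitRep, spinRep_zero_apply]

/-- `(V^{1/2})^{⊗ N}` is a finite direct sum of spins, in which `V^{k/2}` occurs as often as the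
walk with mirror returns to `k / 2`. -/
theorem exists_qubitRep_equiv_pi (N : ℕ) :
    ∃ (ι : Type) (_ : Finite ι) (f : ι → ℕ),
      Nonempty ((qubitRep N).Equiv (pi fun i => spinRep (f i))) ∧
      ∀ k : ℕ, Nat.card {i // f i = k} = mirrorWalkReturns N ((k : ℚ) / 2) := by
  induction N with
  | zero =>
    refine ⟨Unit, inferInstance, fun _ => 0, ⟨qubitZero⟩, fun k => ?_⟩
    rw [mirrorWalkReturns_zero]
    rcases k with _ | k
    · simp
    · have : ((k + 1 : ℕ) : ℚ) / 2 ≠ 0 := by positivity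
      rw [if_neg this]
      simp
  | succ N ih =>
    obtain ⟨ι, hι, f, ⟨e⟩, hf⟩ := ih
    have hfin : ∀ k, Finite (SpinNeighbour k) := fun k =>
      (Set.finite_le_nat (k + 1)).subset fun l (hl : l = k + 1 ∨ l + 1 = k) =>
        show l ≤ k + 1 by omega
    refine ⟨Σ i, SpinNeighbour (f i), inferInstance, fun p => p.2.1, ⟨?_⟩, fun k => ?_⟩
    · exact (qubitSplit N).symm.trans <| (halfTensorCongr e).trans <| (halfTensorPi _).trans <|
        (piCongrRight fun i => clebschGordan (f i)).trans
          (piCurry fun i (l : SpinNeighbour (f i)) => spinRep l.1).symm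
    · have e1 : {p : Σ i, SpinNeighbour (f i) // p.2.1 = k} ≃ {i // k = f i + 1 ∨ k + 1 = f i} :=
        { toFun := fun p => ⟨p.1.1, by have := p.1.2.2; have := p.2; omega⟩
          invFun := fun i => ⟨⟨i.1, k, i.2⟩, rfl⟩
          left_inv := by rintro ⟨⟨i, l, hl⟩, rfl⟩; rfl
          right_inv := fun _ => rfl }
      have hd : Disjoint {i | k = f i + 1} {i | k + 1 = f i} :=
        Set.disjoint_left.2 fun i (h1 : k = _) (h2 : k + 1 = _) => by omega
      have e2 : Nat.card {i // k = f i + 1 ∨ k + 1 = f i} =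
          Nat.card {i // k = f i + 1} + Nat.card {i // k + 1 = f i} :=
        Set.ncard_union_eq hd
      -- neighbours of `k` below and above are the steps `+1/2` and `-1/2` of the walk
      rw [Nat.card_congr e1, e2, mirrorWalkReturns_succ_nat]
      congr 1
      · rcases k with _ | k
        · have := mirrorWalkReturns_of_neg N (h := -1) (by norm_num)
          norm_num at this ⊢
          exact this.symm
        · simp [← hf, eq_comm]
      · have := hf (k + 1)
        push_cast at this
        simp [← this, eq_comm]

end Existence

/-! ### Weights and uniqueness of multiplicities -/

section Weights

/-- The matrix `!![a, b; -conj b, conj a]` of `SU(2)`. -/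
def su2Mk (a b : ℂ) (h : a * star a + b * star b = 1) : SU2 :=
  ⟨!![a, b; -star b, star a], by
    rw [Matrix.mem_specialUnitaryGroup_iff, Matrix.mem_unitaryGroup_iff]
    refine ⟨?_, by rw [Matrix.det_fin_two_of]; linear_combination h⟩
    ext i j
    fin_cases i <;> fin_cases j <;> simp [Matrix.mul_apply, Fin.sum_univ_two] <;>
      simp only [Complex.star_def] at h <;>
      -- the off-diagonal entries vanish identically
      first | ring1 | linear_combination h⟩

/-- The phases `exp (i n)`, the integral powers of `exp i`. -/
def phase (n : ℤ) : ℂ := Complex.exp (n * Complex.I)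

theorem phase_add (m n : ℤ) : phase (m + n) = phase m * phase n := by
  rw [phase, phase, phase, ← Complex.exp_add]
  push_cast
  ring_nf

theorem phase_pow (m : ℤ) (n : ℕ) : phase m ^ n = phase (n * m) := by
  rw [phase, phase, ← Complex.exp_nat_mul]
  push_cast
  ring_nf

theorem phase_zero : phase 0 = 1 := by simp [phase]

theorem star_phase (n : ℤ) : star (phase n) = phase (-n) := by
  rw [phase, phase, Complex.star_def, ← Complex.exp_conj]
  simp

/-- No nontrivial power of `exp i` is `1`, since `π` is irrational. -/
theorem phase_eq_one_iff {n : ℤ} : phase n = 1 ↔ n = 0 := by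
  refine ⟨fun h => ?_, fun h => h ▸ phase_zero⟩
  obtain ⟨m, hm⟩ := Complex.exp_eq_one_iff.1 h
  have h1 : (n : ℝ) = m * (2 * Real.pi) := by
    have : (n : ℂ) = m * (2 * Real.pi) := by
      apply mul_right_cancel₀ Complex.I_ne_zero
      rw [hm]; ring
    exact_mod_cast this
  by_contra hn
  have hm0 : m ≠ 0 := by rintro rfl; simp at h1; exact hn h1
  refine irrational_pi ⟨(n : ℚ) / (2 * m), ?_⟩
  have : (m : ℝ) ≠ 0 := by exact_mod_cast hm0
  push_cast
  rw [h1]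
  field_simp

theorem phase_injective : Function.Injective phase := fun m n h => by
  have : phase (m - n) = 1 := by
    rw [sub_eq_add_neg, phase_add, h, ← phase_add, add_neg_cancel, phase_zero]
  have := phase_eq_one_iff.1 this
  omega

/-- The diagonal matrix with eigenvalues `exp i` and `exp (-i)`. -/
def torusElement : SU2 :=
  su2Mk (phase 1) 0 (by simp [-Complex.star_def, star_phase, ← phase_add, phase_zero])

/-- The weight of the monomial with exponent `d`: the monomial is an eigenvector of `torusElement`
with eigenvalue `exp (i w)` for this `w`. -/
def monomialWeight (d : Fin 2 →₀ ℕ) : ℤ := (d 0 : ℤ) - d 1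

theorem coeff_linSubst_torusElement (p : MvPolynomial (Fin 2) ℂ) (d : Fin 2 →₀ ℕ) :
    coeff d (linSubst torusElement.1 p) = phase (monomialWeight d) * coeff d p := by
  have hX : ∀ i, linSubst torusElement.1 (X i) = C (![phase 1, phase (-1)] i) * X i := fun i => by
    rw [linSubst_X]
    fin_cases i <;> simp [-Complex.star_def, torusElement, su2Mk, star_phase]
  induction p using MvPolynomial.induction_on' with
  | add p q hp hq => simp only [map_add, coeff_add, hp, hq, mul_add]
  | monomial e c =>
    have : linSubst torusElement.1 (monomial e c) =
        C (phase (monomialWeight e)) * monomial e c := by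
      rw [monomial_eq, map_mul, Finsupp.prod_fintype _ _ (fun i => pow_zero _), map_prod]
      simp only [map_pow, hX, Fin.prod_univ_two, mul_pow, Matrix.cons_val_zero, Matrix.cons_val_one]
      rw [← C_pow, ← C_pow, phase_pow, phase_pow]
      rw [monomialWeight, show (e 0 : ℤ) - e 1 = (e 0 : ℤ) * 1 + (e 1 : ℤ) * (-1) by ring,
        phase_add, C_mul, show linSubst torusElement.1 (C c) = C c by simp [linSubst]]
      ring
    rw [this, coeff_C_mul, coeff_monomial]
    split_ifs with h
    · rw [h]
    · simp

/-- The exponents of the monomials of degree `k` in two variables. -/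
abbrev SpinIndex (k : ℕ) : Type := {d : Fin 2 →₀ ℕ // d.degree = k}

/-- The basis of `V^{k/2}` consisting of the monomials. -/
def spinBasis (k : ℕ) : Module.Basis (SpinIndex k) ℂ (SpinSpace k) :=
  .ofRepr ((LinearEquiv.ofEq _ _ (homogeneousSubmodule_eq_finsupp_supported (Fin 2) ℂ k)).trans
    (AddMonoidAlgebra.supportedEquivFinsupp _))

/-- The vectors of weight `w`, the eigenvectors of the diagonal matrix with eigenvalue
`exp (i w)`. -/
def weightSpace {W : Type*} [AddCommMonoid W] [Module ℂ W] (ρ : Representation ℂ SU2 W) (w : ℤ) :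
    Submodule ℂ W :=
  LinearMap.eqLocus (ρ torusElement) (phase w • LinearMap.id)

theorem mem_weightSpace {W : Type*} [AddCommMonoid W] [Module ℂ W] {ρ : Representation ℂ SU2 W}
    {w : ℤ} {v : W} : v ∈ weightSpace ρ w ↔ ρ torusElement v = phase w • v := Iff.rfl

theorem finrank_weightSpace_of_basis {κ W : Type*} [AddCommMonoid W] [Module ℂ W]
    (b : Module.Basis κ ℂ W) (ρ : Representation ℂ SU2 W) (μ : κ → ℤ)
    (hρ : ∀ v i, b.repr (ρ torusElement v) i = phase (μ i) * b.repr v i) (w : ℤ) :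
    Module.finrank ℂ (weightSpace ρ w) = Nat.card {i // μ i = w} := by
  have hmap : (weightSpace ρ w).map (b.repr : W →ₗ[ℂ] κ →₀ ℂ) =
      Finsupp.supported ℂ ℂ {i | μ i = w} := by
    ext v
    obtain ⟨v, rfl⟩ := b.repr.surjective v
    rw [Submodule.mem_map_equiv, LinearEquiv.symm_apply_apply, mem_weightSpace,
      ← b.repr.injective.eq_iff, Finsupp.ext_iff, Finsupp.mem_supported']
    refine forall_congr' fun i => ?_
    simp only [hρ, map_smul, Finsupp.smul_apply, smul_eq_mul, mul_eq_mul_right_iff,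
      phase_injective.eq_iff, Set.mem_ofPred_eq]
    tauto
  rw [((b.repr.submoduleMap _).trans (LinearEquiv.ofEq _ _ hmap)).finrank_eq]
  exact Module.finrank_eq_nat_card_basis (.ofRepr (Finsupp.supportedEquivFinsupp _))

theorem finrank_weightSpace_congr {W W' : Type*} [AddCommMonoid W] [Module ℂ W]
    [AddCommMonoid W'] [Module ℂ W'] {ρ : Representation ℂ SU2 W} {σ : Representation ℂ SU2 W'}
    (e : ρ.Equiv σ) (w : ℤ) :
    Module.finrank ℂ (weightSpace ρ w) = Module.finrank ℂ (weightSpace σ w) := by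
  have he : ∀ v, e (ρ torusElement v) = σ torusElement (e v) :=
    LinearMap.congr_fun (e.isIntertwining' torusElement)
  have hmap : (weightSpace ρ w).map (e.toLinearEquiv : W →ₗ[ℂ] W') = weightSpace σ w := by
    ext v
    obtain ⟨v, rfl⟩ := e.toLinearEquiv.surjective v
    rw [Submodule.mem_map_equiv, LinearEquiv.symm_apply_apply, mem_weightSpace, mem_weightSpace,
      ← e.toLinearEquiv.injective.eq_iff, map_smul]
    exact Eq.congr (he v) rfl
  exact ((e.toLinearEquiv.submoduleMap _).trans (LinearEquiv.ofEq _ _ hmap)).finrank_eq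

/-- The basis of a direct sum of spins consisting of monomials. -/
def spinSumBasis (m : ℕ → ℕ) :
    Module.Basis (Σ p : (Σ k, Fin (m k)), SpinIndex p.1) ℂ
      (DirectSum (Σ k, Fin (m k)) fun p => SpinSpace p.1) :=
  DFinsupp.basis fun p : (Σ k, Fin (m k)) => spinBasis p.1

theorem spinSumBasis_repr (m : ℕ → ℕ) (v : DirectSum (Σ k, Fin (m k)) fun p => SpinSpace p.1)
    (q : Σ p : (Σ k, Fin (m k)), SpinIndex p.1) :
    (spinSumBasis m).repr v q = coeff q.2.1 (v q.1).1 := rfl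

/-- The dimension of the space of vectors of weight `w` in the direct sum of `m k` copies of the
spins `k/2`. -/
def weightMultiplicity (m : ℕ → ℕ) (w : ℤ) : ℕ :=
  Nat.card {q : Σ p : (Σ k, Fin (m k)), SpinIndex p.1 // monomialWeight q.2.1 = w}

theorem finrank_weightSpace_directSum (m : ℕ → ℕ) (w : ℤ) :
    Module.finrank ℂ (weightSpace (directSum fun p : (Σ k, Fin (m k)) => spinRep p.1) w) =
      weightMultiplicity m w := by
  refine finrank_weightSpace_of_basis (spinSumBasis m) _ (fun q => monomialWeight q.2.1)
    (fun v q => ?_) w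
  rw [spinSumBasis_repr, spinSumBasis_repr, directSum_apply, DirectSum.lmap_apply, spinRep_coe,
    coeff_linSubst_torusElement]

/-- `V^{k/2}` has a vector of weight `w` if and only if `k = w + 2 j` for some `j`, which is then
unique up to scalars. -/
theorem weightMultiplicity_eq_card (m : ℕ → ℕ) (w : ℕ) :
    weightMultiplicity m w = Nat.card {p : (Σ k, Fin (m k)) // ∃ j, p.1 = w + 2 * j} := by
  have hdeg : ∀ d : Fin 2 →₀ ℕ, d.degree = d 0 + d 1 := fun d => by
    rw [Finsupp.degree_eq_sum, Fin.sum_univ_two]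
  refine Nat.card_congr (.ofBijective (fun q => ⟨q.1.1, q.1.2.1 1, ?_⟩) ⟨?_, ?_⟩)
  · have h1 := q.1.2.2
    have h2 := q.2
    rw [hdeg] at h1
    rw [monomialWeight] at h2
    omega
  · rintro ⟨⟨p, d, hd⟩, h⟩ ⟨⟨p', d', hd'⟩, h'⟩ hpp
    obtain rfl : p = p' := congrArg Subtype.val hpp
    suffices d = d' by subst this; rfl
    rw [hdeg] at hd hd'
    simp only [monomialWeight] at h h'
    ext i
    fin_cases i <;> simp only [Fin.zero_eta, Fin.mk_one] <;> omega
  · rintro ⟨p, j, hj⟩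
    refine ⟨⟨⟨p, Finsupp.equivFunOnFinite.symm ![w + j, j], ?_⟩, ?_⟩, rfl⟩
    · rw [hdeg, hj]
      simp
      omega
    · simp [monomialWeight]

/-- The weight `w ≥ 0` occurs once in `V^{w/2}` and otherwise only together with the weight
`w + 2`. -/
theorem weightMultiplicity_eq_add (m : ℕ → ℕ) [Finite (Σ k, Fin (m k))] (w : ℕ) :
    weightMultiplicity m w = m w + weightMultiplicity m ((w + 2 : ℕ) : ℤ) := by
  have hu : {p : (Σ k, Fin (m k)) | ∃ j, p.1 = w + 2 * j} =
      {p | p.1 = w} ∪ {p | ∃ j, p.1 = w + 2 + 2 * j} := by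
    ext p
    simp only [Set.mem_ofPred_eq, Set.mem_union]
    constructor
    · rintro ⟨_ | j, hj⟩
      · exact .inl (by omega)
      · exact .inr ⟨j, by omega⟩
    · rintro (h | ⟨j, hj⟩)
      · exact ⟨0, by omega⟩
      · exact ⟨j + 1, by omega⟩
  have hd : Disjoint {p : (Σ k, Fin (m k)) | p.1 = w} {p | ∃ j, p.1 = w + 2 + 2 * j} :=
    Set.disjoint_left.2 fun p (h1 : p.1 = w) ⟨j, hj⟩ => by omega
  have hm : Set.ncard {p : (Σ k, Fin (m k)) | p.1 = w} = m w := by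
    have e : Fin (m w) ≃ {p : (Σ k, Fin (m k)) // p.1 = w} :=
      { toFun := fun i => ⟨⟨w, i⟩, rfl⟩
        invFun := fun p => p.2 ▸ p.1.2
        left_inv := fun _ => rfl
        right_inv := by rintro ⟨⟨k, i⟩, rfl⟩; rfl }
    exact (Nat.card_congr e).symm.trans (Nat.card_fin _)
  rw [weightMultiplicity_eq_card, weightMultiplicity_eq_card, ← hm]
  exact (congrArg Set.ncard hu).trans (Set.ncard_union_eq hd)

/-- The multiplicities of the spins in a finite-dimensional representation are unique. -/
theorem IsSpinDecomposition.unique {W : Type} [AddCommMonoid W] [Module ℂ W] [Module.Finite ℂ W]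
    {ρ : Representation ℂ SU2 W} {m m' : ℕ → ℕ} (h : IsSpinDecomposition ρ m)
    (h' : IsSpinDecomposition ρ m') : m = m' := by
  have hfin : ∀ {m : ℕ → ℕ}, IsSpinDecomposition ρ m → Finite (Σ k, Fin (m k)) := by
    rintro m ⟨e⟩
    have := Module.Finite.equiv e.toLinearEquiv
    have := Module.Finite.finite_basis (spinSumBasis m)
    exact Finite.of_surjective (Sigma.fst : (Σ p : (Σ k, Fin (m k)), SpinIndex p.1) → _) fun p =>
      ⟨⟨p, Finsupp.single 0 p.1, by simp⟩, rfl⟩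
  have := hfin h
  have := hfin h'
  have hw : ∀ w, weightMultiplicity m w = weightMultiplicity m' w := fun w => by
    obtain ⟨e⟩ := h
    obtain ⟨e'⟩ := h'
    rw [← finrank_weightSpace_directSum, ← finrank_weightSpace_directSum,
      ← finrank_weightSpace_congr e, ← finrank_weightSpace_congr e']
  funext k
  have h1 := weightMultiplicity_eq_add m k
  have h2 := weightMultiplicity_eq_add m' k
  rw [hw, hw] at h1
  omega

end Weights

/-! ### Multiplicities of the spins -/

section Decomposition

/-- Equal spins have equivalent representations. -/
def spinRepCast {k l : ℕ} (h : k = l) : (spinRep k).Equiv (spinRep l) :=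
  h ▸ Representation.Equiv.refl _

theorem isSpinDecomposition_of_equiv_pi {W : Type} [AddCommMonoid W] [Module ℂ W]
    {ρ : Representation ℂ SU2 W} {ι : Type} [Finite ι] {f : ι → ℕ}
    (e : ρ.Equiv (pi fun i => spinRep (f i))) :
    IsSpinDecomposition ρ fun k => Nat.card {i // f i = k} := by
  classical
  let ε : (Σ k, Fin (Nat.card {i // f i = k})) ≃ ι :=
    (Equiv.sigmaCongrRight fun k => (Finite.equivFin _).symm).trans (Equiv.sigmaFiberEquiv f)
  have hε : ∀ p, f (ε p) = p.1 := fun p => ((Finite.equivFin {i // f i = p.1}).symm p.2).2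
  have := Fintype.ofFinite ι
  have := Fintype.ofEquiv ι ε.symm
  exact ⟨e.trans <| (piCongrLeft ε fun i => spinRep (f i)).trans <|
    (piCongrRight fun p => spinRepCast (hε p)).trans (directSumEquivPi _).symm⟩

instance (k : ℕ) : Module.Finite ℂ (SpinSpace k) :=
  Module.Finite.iff_fg.2 (homogeneousSubmodule_fg (Fin 2) ℂ k)

theorem isSpinDecomposition_qubitRep_iff (N : ℕ) (m : ℕ → ℕ) :
    IsSpinDecomposition (qubitRep N) m ↔ ∀ k : ℕ, m k = mirrorWalkReturns N ((k : ℚ) / 2) := by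
  obtain ⟨ι, _, f, ⟨e⟩, hf⟩ := exists_qubitRep_equiv_pi N
  have := Module.Finite.equiv e.toLinearEquiv.symm
  have h := isSpinDecomposition_of_equiv_pi e
  simp only [hf] at h
  constructor
  · intro hm
    exact congrFun (hm.unique h)
  · intro hm
    rwa [funext hm]

end Decomposition

/-! ### Invariant vectors -/

section Invariants

theorem eval_smul_of_isHomogeneous {k : ℕ} {p : MvPolynomial (Fin 2) ℂ} (hp : p.IsHomogeneous k)
    (c : ℂ) (v : Fin 2 → ℂ) : eval (fun i => c * v i) p = c ^ k * eval v p := by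
  rw [eval_eq', eval_eq', Finset.mul_sum]
  refine Finset.sum_congr rfl fun d hd => ?_
  have hdk : d 0 + d 1 = k := by
    have := hp (mem_support_iff.1 hd)
    simpa [Finsupp.weight_apply, Finsupp.sum_fintype, Fin.sum_univ_two] using this
  simp only [Fin.prod_univ_two, mul_pow]
  rw [← hdk, pow_add]
  ring

/-- A nontrivial spin has no invariant vectors: an invariant polynomial `p` is constant on the unit
sphere of `ℂ²`, on which `SU(2)` acts transitively, and the scalar `exp i` multiplies this constant
by `exp (i k) ≠ 1`. -/
theorem eq_zero_of_spinRep_invariant {k : ℕ} (hk : k ≠ 0) {p : SpinSpace k}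
    (hp : ∀ g, spinRep k g p = p) : p = 0 := by
  have hhom : p.1.IsHomogeneous k := p.2
  have hsphere : ∀ a b : ℂ, a * star a + b * star b = 1 → eval ![a, b] p.1 = eval ![1, 0] p.1 := by
    intro a b hab
    have h1 := congrArg (eval ![1, 0]) (congrArg Subtype.val (hp (su2Mk a b hab)))
    rw [spinRep_coe, linSubst, aeval_def, eval_eval₂] at h1
    refine Eq.trans ?_ h1
    change eval₂ (RingHom.id ℂ) _ _ = _
    congr 1
    · ext; simp
    · funext i
      fin_cases i <;> simp [su2Mk]
  have h0 : eval ![1, 0] p.1 = 0 := by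
    have h1 := hsphere (phase 1) 0
      (by simp [-Complex.star_def, star_phase, ← phase_add, phase_zero])
    have h2 := eval_smul_of_isHomogeneous hhom (phase 1) ![1, 0]
    rw [show (fun i => phase 1 * ![1, 0] i) = ![phase 1, 0] by ext i; fin_cases i <;> simp, h1,
      phase_pow] at h2
    have h3 : phase (k * 1) ≠ 1 := by rw [Ne, phase_eq_one_iff]; omega
    have h4 : (phase (k * 1) - 1) * eval ![1, 0] p.1 = 0 := by linear_combination -h2
    exact (mul_eq_zero.1 h4).resolve_left (sub_ne_zero.2 h3)
  apply Subtype.ext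
  refine MvPolynomial.funext fun v => ?_
  rw [ZeroMemClass.coe_zero, map_zero]
  set r : ℝ := √(Complex.normSq (v 0) + Complex.normSq (v 1)) with hr
  have hr2 : (r : ℂ) * r = v 0 * star (v 0) + v 1 * star (v 1) := by
    rw [Complex.star_def, Complex.mul_conj, Complex.mul_conj, ← Complex.ofReal_mul, hr,
      Real.mul_self_sqrt (add_nonneg (Complex.normSq_nonneg _) (Complex.normSq_nonneg _)),
      Complex.ofReal_add]
  -- a vector of norm `r ≠ 0` is `r` times a point of the sphere
  rcases eq_or_ne r 0 with h | h
  · have hs := (Real.sqrt_eq_zero (add_nonneg (Complex.normSq_nonneg _)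
      (Complex.normSq_nonneg _))).1 h
    have n0 := Complex.normSq_nonneg (v 0)
    have n1 := Complex.normSq_nonneg (v 1)
    have v0 : v 0 = 0 := Complex.normSq_eq_zero.1 (by linarith)
    have v1 : v 1 = 0 := Complex.normSq_eq_zero.1 (by linarith)
    have := eval_smul_of_isHomogeneous hhom 0 v
    rw [zero_pow hk, zero_mul] at this
    rw [← this]
    congr 2
    funext i
    fin_cases i <;> simp [v0, v1]
  · have hrC : (r : ℂ) ≠ 0 := by exact_mod_cast h
    have hv : v = fun i => (r : ℂ) * ![v 0 / r, v 1 / r] i := by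
      funext i
      fin_cases i <;> simp <;> field_simp
    rw [hv, eval_smul_of_isHomogeneous hhom, hsphere, h0, mul_zero]
    simp only [star_div₀, Complex.star_def, Complex.conj_ofReal] at hr2 ⊢
    field_simp
    linear_combination -hr2

theorem finrank_invariants_congr {G W W' : Type*} [Group G] [AddCommGroup W] [Module ℂ W]
    [AddCommGroup W'] [Module ℂ W'] {ρ : Representation ℂ G W} {σ : Representation ℂ G W'}
    (e : ρ.Equiv σ) :
    Module.finrank ℂ (invariants ρ) = Module.finrank ℂ (invariants σ) := by
  have he : ∀ g w, e (ρ g w) = σ g (e w) := fun g => LinearMap.congr_fun (e.isIntertwining' g)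
  have hmap : (invariants ρ).map (e.toLinearEquiv : W →ₗ[ℂ] W') = invariants σ := by
    ext w
    obtain ⟨v, rfl⟩ := e.toLinearEquiv.surjective w
    rw [Submodule.mem_map_equiv, LinearEquiv.symm_apply_apply, mem_invariants, mem_invariants]
    refine forall_congr' fun g => ?_
    rw [← e.toLinearEquiv.injective.eq_iff]
    exact Eq.congr (he g v) rfl
  exact ((e.toLinearEquiv.submoduleMap _).trans (LinearEquiv.ofEq _ _ hmap)).finrank_eq

/-- The invariant vectors of a sum of spins are the constants in its summands of spin `0`. -/
theorem finrank_invariants_pi {ι : Type} [Finite ι] (f : ι → ℕ) :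
    Module.finrank ℂ (invariants (pi fun i => spinRep (f i))) = Nat.card {i // f i = 0} := by
  classical
  have hC : ∀ {k : ℕ}, k = 0 → ∀ p : SpinSpace k, ∃ c, p.1 = C c := by
    rintro _ rfl p
    exact exists_eq_C_of_spinSpace_zero p
  have hmem : ∀ {k : ℕ}, k = 0 → ∀ c : ℂ, C c ∈ homogeneousSubmodule (Fin 2) ℂ k := by
    rintro _ rfl c
    exact isHomogeneous_C _ c
  let T : invariants (pi fun i => spinRep (f i)) →ₗ[ℂ] ({i // f i = 0} → ℂ) :=
    { toFun := fun v i => constantCoeff (v.1 i.1).1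
      map_add' := fun v w => by ext i; simp
      map_smul' := fun c v => by ext i; simp }
  have hinj : Function.Injective T := by
    rintro ⟨v, hv⟩ ⟨v', hv'⟩ hT
    apply Subtype.ext
    funext i
    by_cases hi : f i = 0
    · obtain ⟨c, hc⟩ := hC hi (v i)
      obtain ⟨c', hc'⟩ := hC hi (v' i)
      have h0 : constantCoeff (v i).1 = constantCoeff (v' i).1 := congrFun hT ⟨i, hi⟩
      rw [hc, hc', constantCoeff_C, constantCoeff_C] at h0
      apply Subtype.ext
      rw [hc, hc', h0]
    · exact (eq_zero_of_spinRep_invariant hi fun g => congrFun (hv g) i).trans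
        (eq_zero_of_spinRep_invariant hi fun g => congrFun (hv' g) i).symm
  have hsurj : Function.Surjective T := by
    intro c
    refine ⟨⟨fun i => if h : f i = 0 then ⟨C (c ⟨i, h⟩), hmem h _⟩ else 0,
      fun g => ?_⟩, ?_⟩
    · funext i
      rw [pi_apply]
      split_ifs with h
      · apply Subtype.ext
        simp [spinRep_coe, linSubst]
      · rw [map_zero]
    · funext ⟨i, hi⟩
      simp [T, hi]
  have := Fintype.ofFinite {i // f i = 0}
  rw [(LinearEquiv.ofBijective T ⟨hinj, hsurj⟩).finrank_eq, Module.finrank_fintype_fun_eq_card,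
    Nat.card_eq_fintype_card]

theorem intertwinerDim_eq (n : ℕ) : intertwinerDim n = mirrorWalkReturns (2 * n) 0 := by
  obtain ⟨ι, _, f, ⟨e⟩, hf⟩ := exists_qubitRep_equiv_pi (2 * n)
  rw [intertwinerDim, finrank_invariants_congr e, finrank_invariants_pi, hf]
  simp

end Invariants

end

theorem proposition1 :
    -- The degeneracies of the spins `k/2` in the decomposition of `(V^{1/2})^{⊗ 2n}` exist, are
    -- unique, and are the numbers of returns to `k/2` of the walk with a mirror.
    (∀ (n : ℕ) (m : ℕ → ℕ), IsSpinDecomposition (qubitRep (2 * n)) m ↔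
      ∀ k : ℕ, m k = mirrorWalkReturns (2 * n) ((k : ℚ) / 2)) ∧
    -- The walk with a mirror in terms of the standard walk, at every spot `k/2`.
    (∀ n k : ℕ, (mirrorWalkReturns (2 * n) ((k : ℚ) / 2) : ℤ) =
      (walkReturns (2 * n) ((k : ℚ) / 2) : ℤ) - (walkReturns (2 * n) ((k : ℚ) / 2 + 1) : ℤ)) ∧
    -- The explicit value at every integer spot `j`.
    (∀ n j : ℕ, walkReturns (2 * n) (j : ℚ) = (2 * n).choose (n + j) ∧
      (mirrorWalkReturns (2 * n) (j : ℚ) : ℤ) =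
        ((2 * n).choose (n + j) : ℤ) - ((2 * n).choose (n + j + 1) : ℤ)) ∧
    -- The dimension of the intertwiner space is the Catalan number.
    (∀ n : ℕ, intertwinerDim n = mirrorWalkReturns (2 * n) 0 ∧ intertwinerDim n = catalan n ∧
      (intertwinerDim n : ℚ) = ((2 * n).choose n : ℚ) / ((n : ℚ) + 1)) ∧
    -- The asymptotics of its logarithm, up to an error that tends to `0`.
    Tendsto (fun n : ℕ => Real.log (intertwinerDim n : ℝ) -
      (2 * (n : ℝ) * Real.log 2 - 3 / 2 * Real.log (n : ℝ) - 1 / 2 * Real.log Real.pi))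
      atTop (𝓝 0) := by

  refine ⟨fun n => isSpinDecomposition_qubitRep_iff (2 * n), fun n k => ?_,
    fun n j => ⟨walkReturns_two_mul n j, mirrorWalkReturns_two_mul n j⟩, fun n => ?_, ?_⟩
  · rw [← mirrorWalkReturns_add (2 * n) k]
    push_cast
    ring
  · have h : intertwinerDim n = catalan n :=
      (intertwinerDim_eq n).trans (mirrorWalkReturns_two_mul_zero n)
    refine ⟨intertwinerDim_eq n, h, ?_⟩
    rw [h, eq_div_iff (by positivity), ← Nat.centralBinom, ← succ_mul_catalan_eq_centralBinom]
    push_cast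
    ring
  · have h : ∀ n, intertwinerDim n = catalan n := fun n =>
      (intertwinerDim_eq n).trans (mirrorWalkReturns_two_mul_zero n)
    simp only [h]
    exact tendsto_log_catalan
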